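/- Let $N\ge 1$, $c>1$ and $0<L\le U$. There is $\varepsilon>0$, depending only on $N,c,L,U$, such that the following holds. Let $\lambda_{1,k}(t),\lambda_{k,1}(t)\in[L,U]$ ($2\le k\le N$, $t=0,1,2,\dots$) be real sequences with $$|\lambda_{1,k}(t+1)-\lambda_{1,k}(t)|\le\varepsilon,\qquad |\lambda_{k,1}(t+1)-\lambda_{k,1}(t)|\le\varepsilon\qquad\text{for all }k,t,$$ and $$\sum_{k=2}^N\lambda_{1,k}(t)\lambda_{k,1}(t)\ge c\qquad\text{for all }t .$$ Let $\mathbf W(t)\in\mathbb R^{N\times N}$ be the star-shaped trust matrix whose first row is $(0,\lambda_{1,2}(t),\dots,\lambda_{1,N}(t))$, whose first column is $(0,\lambda_{2,1}(t),\dots,\lambda_{N,1}(t))^{\mathrm T}$, and whose other entries are $0$ (agent $1$ is the AI, agents $2,\dots,N$ are humans). Let $\mu\in\mathbb R$, $\sigma>0$, and let $o_{i,t}\sim\mathcal N(\mu,\sigma^2)$ ($1\le i\le N$, $t=0,1,2,\dots$) be independent. Define the private precisions and means $\mathbf p_t,\hat{\boldsymbol\mu}_t\in\mathbb R^N$ and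 the aggregate precisions and means $\mathbf q_t,\hat{\boldsymbol\nu}_t\in\mathbb R^N$ by $\mathbf p_0=\mathbf q_0=\mathbf 0$ and, for $t\ge0$, $$\begin{aligned} \mathbf p_{t+1}&=\mathbf p_t+\sigma^{-2}\mathbf 1, & \hat{\boldsymbol\mu}_{t+1}\odot\mathbf p_{t+1}&=\hat{\boldsymbol\mu}_t\odot\mathbf p_t+\sigma^{-2}\mathbf o_t,\\ \mathbf q_{t+1}&=\mathbf p_{t+1}+\mathbf W(t)\,\mathbf q_t, & \hat{\boldsymbol\nu}_{t+1}\odot\mathbf q_{t+1}&=\hat{\boldsymbol\mu}_{t+1}\odot\mathbf p_{t+1}+\mathbf W(t)\,(\hat{\boldsymbol\nu}_t\odot\mathbf q_t), \end{aligned}$$ where $\odot$ is the entrywise product (the values $\hat{\boldsymbol\mu}_0,\hat{\boldsymbol\nu}_0$ play no role). Then for every agent $i\in\{1,\dots,N\}$, $$\Pr\Big[\lim_{t\to\infty}\hat\nu_{i,t}=\mu\Big]=0 .$$ -/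

import Mathlib

open MeasureTheory ProbabilityTheory Filter
open scoped Topology Matrix

namespace TrustDynamics

noncomputable section

/-- Private precisions: `p 0 = 0` and `p (t+1) = p t + σ⁻² 1`. -/
def privatePrecision {N : ℕ} (σ : ℝ) : ℕ → Fin N → ℝ
  | 0 => 0
  | t + 1 => fun i => privatePrecision σ t i + (σ ^ 2)⁻¹

/-- Private posterior means `μ̂`, driven by the observations `o t i`:
`μ̂ (t+1) ⊙ p (t+1) = μ̂ t ⊙ p t + σ⁻² o t`.  There is no prior information (`p 0 = 0`), so the
value at time `0` has no influence on later values. -/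
def privateMean {N : ℕ} (σ : ℝ) (o : ℕ → Fin N → ℝ) : ℕ → Fin N → ℝ
  | 0 => 0
  | t + 1 => fun i =>
      (privateMean σ o t i * privatePrecision (N := N) σ t i + (σ ^ 2)⁻¹ * o t i)
        / privatePrecision (N := N) σ (t + 1) i

/-- Aggregate precisions `q` under the trust matrices `W t`: `q 0 = 0` and
`q (t+1) = p (t+1) + W t * q t`. -/
def aggPrecision {N : ℕ} (σ : ℝ) (W : ℕ → Matrix (Fin N) (Fin N) ℝ) : ℕ → Fin N → ℝ
  | 0 => 0
  | t + 1 => privatePrecision σ (t + 1) + W t *ᵥ aggPrecision σ W t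

/-- Aggregate posterior means `ν̂`:
`ν̂ (t+1) ⊙ q (t+1) = μ̂ (t+1) ⊙ p (t+1) + W t * (ν̂ t ⊙ q t)`.  As `q 0 = 0`, the value at time `0`
has no influence on later values. -/
def aggMean {N : ℕ} (σ : ℝ) (W : ℕ → Matrix (Fin N) (Fin N) ℝ) (o : ℕ → Fin N → ℝ) :
    ℕ → Fin N → ℝ
  | 0 => 0
  | t + 1 =>
      (privateMean σ o (t + 1) * privatePrecision σ (t + 1)
          + W t *ᵥ (aggMean σ W o t * aggPrecision σ W t))
        / aggPrecision σ W (t + 1)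

/-- The star-shaped trust matrix of one AI agent (index `0`) and `n` human agents
(indices `1, …, n`): first row `(0, a₁, …, aₙ)`, first column `(0, b₁, …, bₙ)ᵀ`, zero elsewhere. -/
def starTrust {n : ℕ} (a b : Fin n → ℝ) : Matrix (Fin (n + 1)) (Fin (n + 1)) ℝ :=
  Matrix.of (Fin.cons (Fin.cons 0 a) fun k => Fin.cons (b k) fun _ => 0)

end

end TrustDynamics

/-! The first observation `x` of the AI is never forgotten. The vector `ν̂ t ⊙ q t` is affine in
`x`, with slope `influence`. At the AI, slope and precision obey the same two-step recursion (AI to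
humans and back), whose factor stays above 1 because trust drifts slowly; the precision has an extra
forcing of linear size, negligible against exponential growth (`exists_le_mul_of_two_step`). So
slope over precision stays bounded below. If `ν̂ → μ`, then `x` can be recovered as a limit computed
from the other observations alone. An atomless variable independent of these almost surely avoids
that value (`measure_tendsto_aggMean_eq_zero`). -/

namespace TrustDynamics

section Independence

variable {Ω ι β : Type*} [MeasurableSpace Ω] [MeasurableSpace β] {P : Measure Ω}

/-- A member of an independent family is independent of the tuple of all the others. -/
theorem indepFun_compl {f : ι → Ω → β} (hf : iIndepFun f P) (hm : ∀ i, Measurable (f i)) (i : ι) :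
    IndepFun (fun ω (j : {j // j ≠ i}) => f j ω) (f i) P := by
  rw [IndepFun_iff_Indep]
  have h := indep_iSup_of_disjoint (fun j => (hm j).comap_le) hf.iIndep
    (S := {j | j ≠ i}) (T := {i}) (by simp)
  refine indep_of_indep_of_le_left (indep_of_indep_of_le_right h (by simp)) ?_
  rw [MeasurableSpace.pi, MeasurableSpace.comap_iSup]
  refine iSup_le fun j => ?_
  rw [MeasurableSpace.comap_comp]
  exact le_iSup₂_of_le j.1 j.2 le_rfl

/-- A random variable with a law without atoms almost surely differs from any independent one. -/
theorem measure_eq_null_of_indepFun [IsProbabilityMeasure P] {X Y : Ω → ℝ} (hX : Measurable X)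
    (hY : Measurable Y) (h : IndepFun Y X P) (hna : ∀ x, P.map X {x} = 0) :
    P {ω | X ω = Y ω} = 0 := by
  have hD : MeasurableSet {p : ℝ × ℝ | p.2 = p.1} := measurableSet_eq_fun measurable_snd
    measurable_fst
  have hm : P {ω | X ω = Y ω} = P.map (fun ω => (Y ω, X ω)) {p : ℝ × ℝ | p.2 = p.1} := by
    rw [Measure.map_apply (hY.prodMk hX) hD]; rfl
  have := Measure.isProbabilityMeasure_map hX.aemeasurable (μ := P)
  rw [hm, (indepFun_iff_map_prod_eq_prod_map_map hY.aemeasurable hX.aemeasurable).1 h,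
    Measure.measure_prod_null hD]
  exact Eventually.of_forall fun y => hna y

end Independence

/-! ### Dependence on one first observation, for arbitrary trust matrices -/

section General

variable {N : ℕ} {σ : ℝ}

theorem privatePrecision_eq (t : ℕ) (i : Fin N) : privatePrecision σ t i = (σ ^ 2)⁻¹ * t := by
  induction t with
  | zero => simp [privatePrecision]
  | succ t ih => simp only [privatePrecision, ih]; push_cast; ring

theorem privateMean_mul_privatePrecision (hσ : 0 < σ) (o : ℕ → Fin N → ℝ) (t : ℕ) (i : Fin N) :
    privateMean σ o t i * privatePrecision σ t i = (σ ^ 2)⁻¹ * ∑ s ∈ Finset.range t, o s i := by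
  induction t with
  | zero => simp [privatePrecision]
  | succ t ih =>
    have h : privatePrecision σ (t + 1) i ≠ 0 := by
      rw [privatePrecision_eq]; positivity
    rw [privateMean, div_mul_cancel₀ _ h, ih, Finset.sum_range_succ]
    ring

theorem aggMean_mul_aggPrecision_succ (hσ : 0 < σ) {W : ℕ → Matrix (Fin N) (Fin N) ℝ}
    (hq : ∀ t i, 0 < aggPrecision σ W (t + 1) i) (o : ℕ → Fin N → ℝ) (t : ℕ) :
    aggMean σ W o (t + 1) * aggPrecision σ W (t + 1)
      = (fun i => (σ ^ 2)⁻¹ * ∑ s ∈ Finset.range (t + 1), o s i)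
        + W t *ᵥ (aggMean σ W o t * aggPrecision σ W t) := by
  funext i
  rw [aggMean, Pi.mul_apply, Pi.div_apply, div_mul_cancel₀ _ (hq t i).ne', Pi.add_apply,
    Pi.mul_apply, privateMean_mul_privatePrecision hσ, Pi.add_apply]

theorem measurable_privateMean (t : ℕ) (i : Fin N) :
    Measurable fun o : ℕ → Fin N → ℝ => privateMean σ o t i := by
  induction t with
  | zero => simp [privateMean]
  | succ t ih => simp only [privateMean]; fun_prop

theorem measurable_aggMean (W : ℕ → Matrix (Fin N) (Fin N) ℝ) (t : ℕ) (i : Fin N) :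
    Measurable fun o : ℕ → Fin N → ℝ => aggMean σ W o t i := by
  induction t generalizing i with
  | zero => simp [aggMean]
  | succ t ih =>
    simp only [aggMean, Pi.div_apply, Pi.add_apply, Pi.mul_apply, Matrix.mulVec, dotProduct]
    have := measurable_privateMean (N := N) (σ := σ) (t + 1) i
    fun_prop

/-- The coefficient of agent `j`'s first observation in the vector `ν̂ t ⊙ q t`. -/
noncomputable def influence (σ : ℝ) (W : ℕ → Matrix (Fin N) (Fin N) ℝ) (j : Fin N) :
    ℕ → Fin N → ℝ
  | 0 => 0
  | t + 1 => Pi.single j (σ ^ 2)⁻¹ + W t *ᵥ influence σ W j t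

/-- The recursion for `ν̂ ⊙ q` is linear, and a first observation enters every later partial sum
exactly once. -/
theorem aggMean_mul_aggPrecision_add (hσ : 0 < σ) {W : ℕ → Matrix (Fin N) (Fin N) ℝ}
    (hq : ∀ t i, 0 < aggPrecision σ W (t + 1) i) (j : Fin N) (x : ℝ) {o o' : ℕ → Fin N → ℝ}
    (ho : ∀ s i, o s i = o' s i + if (s, i) = (0, j) then x else 0) (t : ℕ) :
    aggMean σ W o t * aggPrecision σ W t
      = aggMean σ W o' t * aggPrecision σ W t + x • influence σ W j t := by
  induction t with
  | zero => simp [aggMean, influence]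
  | succ t ih =>
    rw [aggMean_mul_aggPrecision_succ hσ hq, aggMean_mul_aggPrecision_succ hσ hq, ih, influence,
      Matrix.mulVec_add, Matrix.mulVec_smul]
    have h : ∀ i, ∑ s ∈ Finset.range (t + 1), o s i
        = ∑ s ∈ Finset.range (t + 1), o' s i + if i = j then x else 0 := by
      intro i
      simp_rw [ho, Finset.sum_add_distrib]
      by_cases hi : i = j <;> simp [hi]
    funext i
    simp only [h, Pi.add_apply, Pi.smul_apply, smul_eq_mul, Pi.single_apply]
    split_ifs <;> ring

/-- If agent `j`'s first observation has no atoms and keeps a share of agent `i`'s aggregate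
precision bounded away from zero, then agent `i`'s aggregate mean almost surely fails to converge
to any prescribed value. -/
theorem measure_tendsto_aggMean_eq_zero (hσ : 0 < σ) {W : ℕ → Matrix (Fin N) (Fin N) ℝ}
    (hq : ∀ t i, 0 < aggPrecision σ W (t + 1) i) (i j : Fin N) {δ : ℝ} (hδ : 0 < δ) {T : ℕ}
    (hinf : ∀ t, T ≤ t → δ * aggPrecision σ W t i ≤ influence σ W j t i)
    {Ω : Type*} [MeasurableSpace Ω] (P : Measure Ω) [IsProbabilityMeasure P]
    {o : ℕ → Fin N → Ω → ℝ} (hind : iIndepFun (fun s : ℕ × Fin N => o s.1 s.2) P)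
    (hm : ∀ t k, AEMeasurable (o t k) P) (hna : ∀ x, P.map (o 0 j) {x} = 0) (μ : ℝ) :
    P {ω | Tendsto (fun t => aggMean σ W (fun t k => o t k ω) t i) atTop (𝓝 μ)} = 0 := by
  classical
  let f : ℕ × Fin N → Ω → ℝ := fun s => (hm s.1 s.2).mk
  have hfo : ∀ s, o s.1 s.2 =ᵐ[P] f s := fun s => (hm s.1 s.2).ae_eq_mk
  have hfm : ∀ s, Measurable (f s) := fun s => (hm s.1 s.2).measurable_mk
  have hfind : iIndepFun f P := hind.congr hfo
  let ext : ({s : ℕ × Fin N // s ≠ (0, j)} → ℝ) → ℕ → Fin N → ℝ := fun y s k =>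
    if h : (s, k) ≠ (0, j) then y ⟨(s, k), h⟩ else 0
  have hext : Measurable ext := by
    refine measurable_pi_lambda _ fun s => measurable_pi_lambda _ fun k => ?_
    by_cases h : (s, k) ≠ (0, j)
    · simpa only [ext, dif_pos h] using measurable_pi_apply _
    · simp only [ext, dif_neg h, measurable_const]
  -- `limsup` makes the candidate value measurable everywhere; it is the actual limit wherever `ν̂`
  -- converges to `μ`.
  let G : ({s : ℕ × Fin N // s ≠ (0, j)} → ℝ) → ℝ := fun y =>
    limsup (fun t => (μ - aggMean σ W (ext y) t i)
      * (aggPrecision σ W t i / influence σ W j t i)) atTop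
  have hG : Measurable G := Measurable.limsup fun t =>
    (measurable_const.sub ((measurable_aggMean W t i).comp hext)).mul_const _
  let R : Ω → ({s : ℕ × Fin N // s ≠ (0, j)} → ℝ) := fun ω s => f s ω
  have hR : Measurable R := measurable_pi_lambda _ fun s => hfm s
  have hnull : P {ω | f (0, j) ω = G (R ω)} = 0 := by
    refine measure_eq_null_of_indepFun (hfm _) (hG.comp hR)
      ((indepFun_compl hfind hfm (0, j)).comp hG measurable_id) fun x => ?_
    rw [← Measure.map_congr (hfo (0, j))]
    exact hna x
  have hae : ∀ᵐ ω ∂P, ∀ s, o s.1 s.2 ω = f s ω := ae_all_iff.2 hfo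
  have hne : ∀ᵐ ω ∂P, f (0, j) ω ≠ G (R ω) := by
    rw [ae_iff]; simpa using hnull
  rw [← compl_compl {ω | _}, ← mem_ae_iff]
  filter_upwards [hae, hne] with ω h1 h2 hlim
  refine h2 (Tendsto.limsup_eq ?_).symm
  have hdec := fun t => congrFun (aggMean_mul_aggPrecision_add hσ hq j (f (0, j) ω)
    (o := fun t k => o t k ω) (o' := ext (R ω)) (fun s k => by
      by_cases h : (s, k) = (0, j)
      · rw [Prod.mk.injEq] at h
        simp [ext, h.1, h.2, h1 (0, j)]
      · rw [if_neg h, add_zero]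
        have hk : ext (R ω) s k = f (s, k) ω := dif_pos h
        exact (h1 (s, k)).trans hk.symm) t) i
  have hpos : ∀ t, T + 1 ≤ t → 0 < aggPrecision σ W t i := fun t ht => by
    obtain ⟨s, rfl⟩ : ∃ s, t = s + 1 := ⟨t - 1, by omega⟩
    exact hq s i
  have hzero : Tendsto (fun t => δ⁻¹ * |aggMean σ W (fun t k => o t k ω) t i - μ|) atTop (𝓝 0) := by
    have := ((Tendsto.sub_const hlim μ).abs).const_mul δ⁻¹
    simpa using this
  rw [tendsto_iff_dist_tendsto_zero]
  refine squeeze_zero' (Eventually.of_forall fun _ => dist_nonneg) ?_ hzero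
  filter_upwards [eventually_ge_atTop (T + 1)] with t ht
  have hq' := hpos t ht
  have hi := hinf t (by omega)
  have hi' : 0 < influence σ W j t i := (mul_pos hδ hq').trans_le hi
  have hd := hdec t
  simp only [Pi.mul_apply, Pi.add_apply, Pi.smul_apply, smul_eq_mul] at hd
  have key : (μ - aggMean σ W (ext (R ω)) t i) * (aggPrecision σ W t i / influence σ W j t i)
      - f (0, j) ω = -(aggMean σ W (fun t k => o t k ω) t i - μ)
        * (aggPrecision σ W t i / influence σ W j t i) := by
    field_simp
    linarith
  rw [Real.dist_eq, key, abs_mul, abs_neg, abs_of_pos (div_pos hq' hi'), mul_comm]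
  refine mul_le_mul_of_nonneg_right ?_ (abs_nonneg _)
  rw [div_le_iff₀ hi', ← div_eq_inv_mul, le_div_iff₀ hδ]
  linarith

end General

/-- Two-step recursions with growth factor at least `c > 1`: a linear forcing term does not change
the order of growth. -/
theorem exists_le_mul_of_two_step {u g m : ℕ → ℝ} {c C : ℝ} (hc : 1 < c) (hC : 0 ≤ C)
    (hm : ∀ t, c ≤ m t) (hu : ∀ t, u (t + 2) ≤ C * (t + 1) + m t * u t)
    (hg : ∀ t, m t * g t ≤ g (t + 2)) (hg0 : 0 < g 0) (hg1 : 0 < g 1) :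
    ∃ K, 0 < K ∧ ∀ t : ℕ, u t + (t + 1) ≤ K * g t := by
  have hc' : 0 < c - 1 := by linarith
  -- The induction needs the stronger bound `u t + D * t + E ≤ K * g t`; `D` and `E` absorb the
  -- coefficient of `t` and the constant term of the forcing.
  obtain ⟨D, hD1, hD⟩ : ∃ D, 1 ≤ D ∧ C + D ≤ c * D := by
    refine ⟨C / (c - 1) + 1, by have := div_nonneg hC hc'.le; linarith, ?_⟩
    have : (c - 1) * (C / (c - 1)) = C := mul_div_cancel₀ _ hc'.ne'
    nlinarith
  obtain ⟨E, hE1, hE⟩ : ∃ E, 1 ≤ E ∧ C + 2 * D + E ≤ c * E := by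
    refine ⟨(C + 2 * D) / (c - 1) + 1, ?_, ?_⟩
    · have := div_nonneg (a := C + 2 * D) (by linarith) hc'.le
      linarith
    · have : (c - 1) * ((C + 2 * D) / (c - 1)) = C + 2 * D := mul_div_cancel₀ _ hc'.ne'
      nlinarith
  have h0 := le_max_left ((u 0 + E) / g 0) ((u 1 + D + E) / g 1)
  have h1 := le_max_right ((u 0 + E) / g 0) ((u 1 + D + E) / g 1)
  set M := max ((u 0 + E) / g 0) ((u 1 + D + E) / g 1)
  rw [div_le_iff₀ hg0] at h0
  rw [div_le_iff₀ hg1] at h1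
  have hM : M ≤ max M 1 := le_max_left _ _
  have hK : (0 : ℝ) < max M 1 := lt_max_of_lt_right one_pos
  set K := max M 1
  have main : ∀ t : ℕ, u t + D * t + E ≤ K * g t := by
    intro t
    induction t using Nat.twoStepInduction with
    | zero =>
      have := mul_le_mul_of_nonneg_right hM hg0.le
      simp only [Nat.cast_zero, mul_zero]
      linarith
    | one =>
      have := mul_le_mul_of_nonneg_right hM hg1.le
      simp only [Nat.cast_one, mul_one]
      linarith
    | more t ih _ =>
      have ht : (0 : ℝ) ≤ t := t.cast_nonneg
      have hmt := hm t
      have h2 := mul_le_mul_of_nonneg_left ih (by linarith : 0 ≤ m t)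
      have h3 := mul_le_mul_of_nonneg_left (hg t) hK.le
      have h4 := mul_le_mul_of_nonneg_right hmt
        (by have := mul_nonneg (by linarith : 0 ≤ D) ht; linarith : 0 ≤ D * t + E)
      have h5 := mul_le_mul_of_nonneg_right hD ht
      have h6 := hu t
      push_cast
      linarith
  refine ⟨K, hK, fun t => ?_⟩
  have ht : (0 : ℝ) ≤ t := t.cast_nonneg
  have := main t
  have := mul_le_mul_of_nonneg_right hD1 ht
  linarith

/-! ### The star-shaped trust matrix -/

section Star

variable {n : ℕ}

theorem starTrust_mulVec_zero (a b : Fin n → ℝ) (v : Fin (n + 1) → ℝ) :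
    (starTrust a b *ᵥ v) 0 = ∑ k, a k * v k.succ := by
  simp [starTrust, Matrix.mulVec, dotProduct, Fin.sum_univ_succ]

theorem starTrust_mulVec_succ (a b : Fin n → ℝ) (v : Fin (n + 1) → ℝ) (k : Fin n) :
    (starTrust a b *ᵥ v) k.succ = b k * v 0 := by
  simp [starTrust, Matrix.mulVec, dotProduct, Fin.sum_univ_succ]

variable {σ L U : ℝ} {a b : ℕ → Fin n → ℝ}

theorem aggPrecision_star_zero (t : ℕ) :
    aggPrecision σ (fun t => starTrust (a t) (b t)) (t + 1) 0
      = (σ ^ 2)⁻¹ * (t + 1)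
        + ∑ k, a t k * aggPrecision σ (fun t => starTrust (a t) (b t)) t k.succ := by
  rw [aggPrecision, Pi.add_apply, privatePrecision_eq, starTrust_mulVec_zero]
  push_cast; rfl

theorem aggPrecision_star_succ (t : ℕ) (k : Fin n) :
    aggPrecision σ (fun t => starTrust (a t) (b t)) (t + 1) k.succ
      = (σ ^ 2)⁻¹ * (t + 1)
        + b t k * aggPrecision σ (fun t => starTrust (a t) (b t)) t 0 := by
  rw [aggPrecision, Pi.add_apply, privatePrecision_eq, starTrust_mulVec_succ]
  push_cast; rfl

theorem aggPrecision_star_nonneg (ha : ∀ t k, 0 ≤ a t k) (hb : ∀ t k, 0 ≤ b t k) (t : ℕ)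
    (i : Fin (n + 1)) : 0 ≤ aggPrecision σ (fun t => starTrust (a t) (b t)) t i := by
  induction t generalizing i with
  | zero => simp [aggPrecision]
  | succ t ih =>
    refine Fin.cases ?_ (fun k => ?_) i
    · rw [aggPrecision_star_zero]
      have := Finset.sum_nonneg fun k (_ : k ∈ Finset.univ) => mul_nonneg (ha t k) (ih k.succ)
      positivity
    · rw [aggPrecision_star_succ]
      have := mul_nonneg (hb t k) (ih 0)
      positivity

theorem aggPrecision_star_pos (hσ : 0 < σ) (ha : ∀ t k, 0 ≤ a t k) (hb : ∀ t k, 0 ≤ b t k) (t : ℕ)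
    (i : Fin (n + 1)) : 0 < aggPrecision σ (fun t => starTrust (a t) (b t)) (t + 1) i := by
  refine Fin.cases ?_ (fun k => ?_) i
  · rw [aggPrecision_star_zero]
    have := Finset.sum_nonneg fun k (_ : k ∈ Finset.univ) =>
      mul_nonneg (ha t k) (aggPrecision_star_nonneg (σ := σ) ha hb t k.succ)
    positivity
  · rw [aggPrecision_star_succ]
    have := mul_nonneg (hb t k) (aggPrecision_star_nonneg (σ := σ) ha hb t 0)
    positivity

theorem influence_star_zero (t : ℕ) :
    influence σ (fun t => starTrust (a t) (b t)) 0 (t + 1) 0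
      = (σ ^ 2)⁻¹ + ∑ k, a t k * influence σ (fun t => starTrust (a t) (b t)) 0 t k.succ := by
  rw [influence, Pi.add_apply, Pi.single_eq_same, starTrust_mulVec_zero]

theorem influence_star_succ (t : ℕ) (k : Fin n) :
    influence σ (fun t => starTrust (a t) (b t)) 0 (t + 1) k.succ
      = b t k * influence σ (fun t => starTrust (a t) (b t)) 0 t 0 := by
  rw [influence, Pi.add_apply, Pi.single_eq_of_ne (Fin.succ_ne_zero k), zero_add,
    starTrust_mulVec_succ]

/-- The share of the AI agent's first observation in the aggregate precision of the AI agent is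
bounded away from zero. -/
theorem exists_aggPrecision_star_zero_le (hσ : 0 < σ) {c : ℝ} (hc : 1 < c)
    (ha : ∀ t k, a t k ∈ Set.Icc L U) (hm : ∀ t, c ≤ ∑ k, a (t + 1) k * b t k) :
    ∃ K, 0 < K ∧ ∀ t : ℕ, aggPrecision σ (fun t => starTrust (a t) (b t)) (t + 1) 0 + (t + 1)
      ≤ K * influence σ (fun t => starTrust (a t) (b t)) 0 (t + 1) 0 := by
  set W := fun t => starTrust (a t) (b t) with hW
  have hγ : 0 < (σ ^ 2)⁻¹ := by positivity
  have hC : 0 ≤ (σ ^ 2)⁻¹ * (3 + 2 * (n * |U|)) := by positivity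
  -- Time is shifted by one since `influence` vanishes at time `0`.
  refine exists_le_mul_of_two_step (u := fun t => aggPrecision σ W (t + 1) 0)
    (g := fun t => influence σ W 0 (t + 1) 0) (m := fun t => ∑ k, a (t + 2) k * b (t + 1) k) hc hC
    (fun t => hm (t + 1)) (fun t => ?_) (fun t => ?_) ?_ ?_
  · have ht : (0 : ℝ) ≤ t := t.cast_nonneg
    have hsum : ∑ k, a (t + 2) k ≤ n * |U| := by
      calc ∑ k, a (t + 2) k ≤ ∑ _k : Fin n, |U| :=
            Finset.sum_le_sum fun k _ => (ha _ k).2.trans (le_abs_self U)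
        _ = n * |U| := by simp
    simp only [hW, aggPrecision_star_zero (t + 2), aggPrecision_star_succ (t + 1), mul_add,
      Finset.sum_add_distrib, ← mul_assoc, ← Finset.sum_mul]
    push_cast
    have h1 := mul_le_mul_of_nonneg_right hsum (by positivity : 0 ≤ (σ ^ 2)⁻¹ * ((t : ℝ) + 2))
    have h2 : 0 ≤ (σ ^ 2)⁻¹ * ((n * |U|) * t) := by positivity
    have h3 : 0 ≤ (σ ^ 2)⁻¹ * (t : ℝ) := by positivity
    linarith
  · simp only [hW, influence_star_zero (t + 2), influence_star_succ (t + 1), ← mul_assoc,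
      ← Finset.sum_mul]
    linarith
  · have h0 : ∀ j, influence σ W 0 0 j = 0 := fun _ => rfl
    simp only [hW, influence_star_zero] at h0 ⊢
    simpa [h0] using pow_pos hσ 2
  · have h0 : influence σ W 0 0 0 = 0 := rfl
    simp only [hW, influence_star_zero (0 + 1), influence_star_succ] at h0 ⊢
    simpa [h0] using pow_pos hσ 2

/-- Humans inherit the AI's bound one step later. Time `1` is excluded because `x` has not reached
them yet. -/
theorem exists_mul_aggPrecision_star_le (hσ : 0 < σ) (hL : 0 < L) {c : ℝ} (hc : 1 < c)
    (ha : ∀ t k, a t k ∈ Set.Icc L U) (hb : ∀ t k, b t k ∈ Set.Icc L U)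
    (hm : ∀ t, c ≤ ∑ k, a (t + 1) k * b t k) (i : Fin (n + 1)) :
    ∃ δ, 0 < δ ∧ ∀ t, 2 ≤ t → δ * aggPrecision σ (fun t => starTrust (a t) (b t)) t i
      ≤ influence σ (fun t => starTrust (a t) (b t)) 0 t i := by
  obtain ⟨K, hK, h⟩ := exists_aggPrecision_star_zero_le hσ hc ha hm
  suffices ∃ K', 0 < K' ∧ ∀ t, aggPrecision σ (fun t => starTrust (a t) (b t)) (t + 2) i
      ≤ K' * influence σ (fun t => starTrust (a t) (b t)) 0 (t + 2) i by
    obtain ⟨K', hK', h'⟩ := this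
    refine ⟨K'⁻¹, inv_pos.2 hK', fun t ht => ?_⟩
    obtain ⟨s, rfl⟩ : ∃ s, t = s + 2 := ⟨t - 2, by omega⟩
    rw [inv_mul_le_iff₀ hK']
    exact h' s
  refine Fin.cases ?_ (fun k => ?_) i
  · refine ⟨K, hK, fun t => ?_⟩
    have := h (t + 1)
    have : (0 : ℝ) ≤ (t + 1 : ℕ) := Nat.cast_nonneg _
    linarith
  · have hγ : 0 < (σ ^ 2)⁻¹ := by positivity
    refine ⟨K * (1 + 2 * (σ ^ 2)⁻¹ / L), by positivity, fun t => ?_⟩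
    rw [aggPrecision_star_succ (t + 1), influence_star_succ (t + 1)]
    have ht : (0 : ℝ) ≤ t := t.cast_nonneg
    have hbt := (hb (t + 1) k).1
    have hq := (aggPrecision_star_nonneg (σ := σ) (fun t k => hL.le.trans (ha t k).1)
      (fun t k => hL.le.trans (hb t k).1) (t + 1) 0)
    have h0 := h t
    set q := aggPrecision σ (fun t => starTrust (a t) (b t)) (t + 1) 0
    set f := influence σ (fun t => starTrust (a t) (b t)) 0 (t + 1) 0
    have h1 : b (t + 1) k * q ≤ b (t + 1) k * (K * f) :=
      mul_le_mul_of_nonneg_left (by linarith) (hL.le.trans hbt)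
    -- The spare `t + 1` in the AI's bound pays for the human's private precision.
    have h2 : 2 * (σ ^ 2)⁻¹ * (t + 1) ≤ 2 * (σ ^ 2)⁻¹ / L * (b (t + 1) k * (K * f)) := by
      rw [div_mul_eq_mul_div, le_div_iff₀ hL, mul_assoc]
      refine mul_le_mul_of_nonneg_left ?_ (by positivity)
      rw [mul_comm]
      exact mul_le_mul hbt (by linarith) (by positivity) (hL.le.trans hbt)
    have h3 : 0 ≤ (σ ^ 2)⁻¹ * (t : ℝ) := by positivity
    push_cast
    linarith

end Star

end TrustDynamics

open TrustDynamics in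
theorem mainTheorem5 (n : ℕ) (c L U : ℝ) (hc : 1 < c) (hL : 0 < L) :
    ∃ ε : ℝ, 0 < ε ∧
      ∀ (a b : ℕ → Fin n → ℝ),
        (∀ t k, a t k ∈ Set.Icc L U) →
        (∀ t k, b t k ∈ Set.Icc L U) →
        (∀ t k, |a (t + 1) k - a t k| ≤ ε) →
        (∀ t k, |b (t + 1) k - b t k| ≤ ε) →
        (∀ t, c ≤ ∑ k, a t k * b t k) →
        ∀ {Ω : Type*} [MeasurableSpace Ω] (P : Measure Ω) [IsProbabilityMeasure P]
          (μ σ : ℝ), 0 < σ →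
          ∀ o : ℕ → Fin (n + 1) → Ω → ℝ,
            iIndepFun (fun (s : ℕ × Fin (n + 1)) => o s.1 s.2) P →
            (∀ t i, HasLaw (o t i) (gaussianReal μ ⟨σ ^ 2, sq_nonneg σ⟩) P) →
            ∀ i : Fin (n + 1),
              P {ω | Tendsto
                (fun t => TrustDynamics.aggMean σ
                  (fun t => TrustDynamics.starTrust (a t) (b t)) (fun t j => o t j ω) t i)
                atTop (𝓝 μ)} = 0 := by
  -- Pairing `a (t + 1)` with `b t` rather than `b (t + 1)` costs at most `n * |U| * ε ≤ (c - 1) /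
  -- 2`, leaving the factor `(1 + c) / 2 > 1`.
  have hε : 0 < (c - 1) / 2 / (n * |U| + 1) := div_pos (by linarith) (by positivity)
  refine ⟨_, hε, ?_⟩
  intro a b ha hb _ hbε hab Ω _ P _ μ σ hσ o hind hlaw i
  have hm : ∀ t, (1 + c) / 2 ≤ ∑ k, a (t + 1) k * b t k := by
    intro t
    have h1 : ∑ k, a (t + 1) k * (b (t + 1) k - b t k)
        ≤ ∑ _k : Fin n, |U| * ((c - 1) / 2 / (n * |U| + 1)) := by
      refine Finset.sum_le_sum fun k _ => ?_
      have h0 : 0 ≤ a (t + 1) k := hL.le.trans (ha _ k).1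
      exact (mul_le_mul_of_nonneg_left ((le_abs_self _).trans (hbε t k)) h0).trans
        (mul_le_mul_of_nonneg_right ((ha _ k).2.trans (le_abs_self U)) hε.le)
    have h2 : n * |U| * ((c - 1) / 2 / (n * |U| + 1)) ≤ (c - 1) / 2 := by
      rw [mul_div_assoc', div_le_iff₀ (by positivity)]
      linarith
    have h3 := hab (t + 1)
    simp only [Finset.sum_const, Finset.card_univ, Fintype.card_fin, nsmul_eq_mul, mul_sub,
      Finset.sum_sub_distrib] at h1
    linarith
  obtain ⟨δ, hδ, hinf⟩ := exists_mul_aggPrecision_star_le hσ hL (by linarith) ha hb hm i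
  refine measure_tendsto_aggMean_eq_zero hσ (aggPrecision_star_pos hσ
    (fun t k => hL.le.trans (ha t k).1) fun t k => hL.le.trans (hb t k).1) i 0 hδ hinf P hind
    (fun t k => (hlaw t k).aemeasurable) (fun x => ?_) μ
  have hv : (⟨σ ^ 2, sq_nonneg σ⟩ : NNReal) ≠ 0 := fun h => by
    have h' : σ ^ 2 = 0 := congrArg NNReal.toReal h
    exact (pow_pos hσ 2).ne' h'
  have := nullSingletonClass_gaussianReal (μ := μ) hv
  rw [(hlaw 0 0).map_eq]
  exact measure_singleton x
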